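/- Let $d\ge 1$, $g\ge 0$, and let $G$ be a finite polygon decomposition (vertices $\mathcal G_0$, edges $\mathcal G_1$, faces $\mathcal G_2$) of a connected closed oriented surface of genus $g$, such that every edge lies between two different vertices and is shared by two different faces. Each edge has a fixed orientation; faces inherit the orientation of the surface. Let $\mathcal H_G=\bigotimes_{e\in\mathcal G_1}\mathbb C^d$, where $\mathbb C^d$ has orthonormal basis $\{l_i\}_{i\in\mathbb Z_d}$, and let $Xl_i=l_{i+1}$, $Zl_i=\omega^i l_i$ with $\omega=e^{2\pi \mathrm i/d}$. For a vertex $v$ let $a_v=\prod_{e\ni v}X_e^{\pm1}$ ($+$ if $e$ is incoming to $v$, $-$ if it is outgoing), and for a face $f$ let $b_f=\prod_{e\in f}Z_e^{\pm1}$ ($+$ if $e$ has the positive orientation with respect to $f$, $-$ otherwise). Put $A_v=\frac1d\sum_{j=0}^{d-1}a_v^j$, $B_f=\frac1d\sum_{j=0}^{d-1}b_f^j$ and $H_G=-\sum_vA_v-\sum_fB_f$, and let $\mathcal S_G$ be the ground state space of $H_G$, i.e. its eigenspace for the lowest eigenvalue. For a $1$-cochain $\gamma=(\gamma_e)\in(\mathbb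 Z_d)^{\mathcal G_1}$ let $X_\gamma=\prod_eX_e^{\gamma_e}$. Let $K$ be the finite group generated by $\{a_v: v\in\mathcal G_0\}$, let $\Omega=\bigotimes_e l_0$, and let $$\Psi_0=|K|^{-1/2}\sum_{h\in K}h\,\Omega .$$ The first cohomology group $H^1(G;\mathbb Z_d)$ (cocycles modulo coboundaries) is isomorphic to $(\mathbb Z_d)^g\oplus(\mathbb Z_d)^g$. Moreover, for every group isomorphism $\theta:(\mathbb Z_d)^g\oplus(\mathbb Z_d)^g\to H^1(G;\mathbb Z_d)$ and every choice of cocycles $\gamma_{\alpha,\beta}$ representing the classes $\theta(\alpha,\beta)$, writing $X_{\alpha,\beta}=X_{\gamma_{\alpha,\beta}}$, the family $$\Psi_{\alpha,\beta}=X_{\alpha,\beta}\Psi_0,\qquad \alpha,\beta\in(\mathbb Z_d)^g,$$ is an orthonormal basis of $\mathcal S_G$. -/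

import Mathlib

noncomputable section

namespace KitaevModel

/-! ### Polygon decompositions of closed oriented surfaces -/

/-- The orientation-reversing involution on the oriented edges (darts).  The dart `(e, true)` is the
edge `e` with its fixed orientation, and `(e, false)` is `e` with the opposite orientation. -/
def dartRev (E : Type*) : Equiv.Perm (E × Bool) where
  toFun x := (x.1, !x.2)
  invFun x := (x.1, !x.2)
  left_inv x := by simp
  right_inv x := by simp

/-- A polygon decomposition of a connected closed oriented surface, with vertices `V`, edges `E`
(each carrying a fixed orientation) and faces `F`, encoded as a combinatorial map (rotation system):
`rot` sends a dart to the next dart, counterclockwise, with the same origin.  The vertices are the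
cycles of `rot`.  Walking along a dart `x` and then along `rot⁻¹ (dartRev x)` one follows
counterclockwise the boundary of the face on the left-hand side of `x`, so that the faces are the
cycles of `rot⁻¹ * dartRev`.  The surface is obtained by gluing one polygonal disc along each of
these cycles. -/
structure PolygonDecomposition (V E F : Type*) where
  /-- next dart, counterclockwise, around the common origin -/
  rot : Equiv.Perm (E × Bool)
  /-- the origin of a dart -/
  org : E × Bool → V
  /-- the face on the left-hand side of a dart -/
  left : E × Bool → F
  org_surjective : Function.Surjective org
  left_surjective : Function.Surjective left
  org_eq_iff : ∀ x y, org x = org y ↔ rot.SameCycle x y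
  left_eq_iff : ∀ x y, left x = left y ↔ (rot⁻¹ * dartRev E).SameCycle x y
  /-- there is at least one edge -/
  nonempty : Nonempty E
  /-- the surface is connected -/
  connected : ∀ x y, ∃ w ∈ Subgroup.closure {rot, dartRev E}, w x = y
  /-- an edge lies between two different vertices -/
  ends_ne : ∀ e, org (e, true) ≠ org (e, false)
  /-- an edge is shared by two different faces -/
  faces_ne : ∀ e, left (e, true) ≠ left (e, false)

namespace PolygonDecomposition

variable {V E F : Type*} (G : PolygonDecomposition V E F)

/-- The vertex from which the edge `e` is outgoing. -/
def src (e : E) : V := G.org (e, true)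

/-- The vertex into which the edge `e` is incoming. -/
def tgt (e : E) : V := G.org (e, false)

/-- The underlying surface has genus `g`: `|V| - |E| + |F| = 2 - 2g`. -/
def HasGenus (_G : PolygonDecomposition V E F) [Fintype V] [Fintype E] [Fintype F] (g : ℕ) :
    Prop :=
  (Fintype.card V : ℤ) - Fintype.card E + Fintype.card F = 2 - 2 * g

variable (d : ℕ)

/-- The `1`-cochain of the edges at `v`: the sign of `e` is `+1` if `e` is incoming to `v`, `-1` if
`e` is outgoing from `v`, and `0` if `v` is not a vertex of `e`. -/
def star [DecidableEq V] (v : V) : E → ZMod d := fun e =>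
  (if G.tgt e = v then 1 else 0) - (if G.src e = v then 1 else 0)

/-- The `1`-chain `∂f`: the sign of `e` is `+1` (`-1`) if `e` has the positive (negative)
orientation with respect to the face `f`, and `0` if `e` is not an edge of `f`. -/
def faceBoundary [DecidableEq F] (f : F) : E → ZMod d := fun e =>
  (if G.left (e, true) = f then 1 else 0) - (if G.left (e, false) = f then 1 else 0)

/-- The coboundary `C⁰ → C¹`, i.e. the boundary map from the faces to the edges of the dual
decomposition; it sends `v` to `star v`. -/
def coboundary₀ [Fintype V] [DecidableEq V] : (V → ZMod d) →ₗ[ZMod d] (E → ZMod d) where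
  toFun u := ∑ v, u v • G.star d v
  map_add' u w := by simp [add_smul, Finset.sum_add_distrib]
  map_smul' r u := by simp [mul_smul, Finset.smul_sum]

/-- The coboundary `C¹ → C²`, i.e. the boundary map from the edges to the vertices of the dual
decomposition: the dual edge of `e` goes from the face on the right of `e` to the one on its left. -/
def coboundary₁ [Fintype E] [DecidableEq F] : (E → ZMod d) →ₗ[ZMod d] (F → ZMod d) where
  toFun c f := ∑ e, c e * G.faceBoundary d f e
  map_add' u w := by ext; simp [add_mul, Finset.sum_add_distrib]
  map_smul' r u := by ext; simp [mul_assoc, Finset.mul_sum]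

variable [Fintype V] [Fintype E] [DecidableEq V] [DecidableEq F]

/-- The group of `1`-cocycles with coefficients in `ℤ/d`. -/
def cocycles : Submodule (ZMod d) (E → ZMod d) := LinearMap.ker (G.coboundary₁ d)

/-- The group of `1`-coboundaries with coefficients in `ℤ/d`. -/
def coboundaries : Submodule (ZMod d) (E → ZMod d) := LinearMap.range (G.coboundary₀ d)

theorem coboundaries_le_cocycles : G.coboundaries d ≤ G.cocycles d := by
  classical
  rintro _ ⟨u, rfl⟩
  have hu : ∀ e, G.coboundary₀ d u e = u (G.tgt e) - u (G.src e) := by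
    intro e
    simp [coboundary₀, star, mul_sub, Finset.sum_sub_distrib]
  rw [cocycles, LinearMap.mem_ker]
  ext f
  change ∑ e, G.coboundary₀ d u e * G.faceBoundary d f e = 0
  let ind : E × Bool → ZMod d := fun x => if G.left x = f then 1 else 0
  have key : ∑ x : E × Bool, ind x * (u (G.org (dartRev E x)) - u (G.org x)) = 0 := by
    simp only [mul_sub, Finset.sum_sub_distrib]
    rw [sub_eq_zero, ← Equiv.sum_comp (G.rot⁻¹ * dartRev E) (fun x => ind x * u (G.org x))]
    refine Finset.sum_congr rfl fun x _ => ?_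
    have h1 : G.left ((G.rot⁻¹ * dartRev E) x) = G.left x :=
      (G.left_eq_iff _ _).2 (Equiv.Perm.sameCycle_apply_left.2 (Equiv.Perm.SameCycle.refl _ _))
    have h2 : G.org ((G.rot⁻¹ * dartRev E) x) = G.org (dartRev E x) := by
      refine (G.org_eq_iff _ _).2 ?_
      rw [Equiv.Perm.mul_apply]
      exact ⟨1, by simp⟩
    simp only [ind, h1, h2]
  rw [Fintype.sum_prod_type] at key
  rw [← key]
  refine Finset.sum_congr rfl fun e _ => ?_
  rw [hu, Fintype.sum_bool]
  simp only [ind, faceBoundary, dartRev, Equiv.coe_fn_mk, Bool.not_true, Bool.not_false, src, tgt]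
  ring

/-- The first cohomology group with coefficients in `ℤ/d`: cocycles modulo coboundaries. -/
abbrev H1 : Type _ := G.cocycles d ⧸ (G.coboundaries d).submoduleOf (G.cocycles d)

/-- The cohomology class of a cocycle. -/
def cohomologyClass (c : G.cocycles d) : G.H1 d := Submodule.Quotient.mk c

end PolygonDecomposition

/-! ### The quantum spin system -/

/-- The total Hilbert space `⨂_{e ∈ E} ℂ^d`, through its orthonormal product basis
`⨂_e l_{k e}`, indexed by the configurations `k : E → ℤ/d`. -/
abbrev StateSpace (E : Type*) [Fintype E] [DecidableEq E] (d : ℕ) [NeZero d] : Type _ :=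
  EuclideanSpace ℂ (E → ZMod d)

/-- The primitive root of unity `ω = exp (2πi / d)`. -/
def omega (d : ℕ) : unitary ℂ :=
  ⟨Complex.exp (2 * Real.pi * Complex.I / d), by
    rw [Unitary.mem_iff_self_mul_star]
    have h : star (Complex.exp (2 * Real.pi * Complex.I / d))
        = Complex.exp (-(2 * Real.pi * Complex.I / d)) := by
      rw [Complex.star_def, ← Complex.exp_conj]
      simp [neg_div, Complex.conj_ofNat]
    rw [h, ← Complex.exp_add]
    simp⟩

section Operators

variable {E : Type*} [Fintype E] [DecidableEq E] {d : ℕ} [NeZero d]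

/-- The product basis vector `⨂_e l_{k e}`. -/
def productState (k : E → ZMod d) : StateSpace E d := EuclideanSpace.single k 1

/-- The operator `X_e`, acting on the spin at `e` as `X l_i = l_{i+1}`. -/
def siteX (e : E) : StateSpace E d ≃ₗᵢ[ℂ] StateSpace E d :=
  LinearIsometryEquiv.piLpCongrLeft 2 ℂ ℂ (Equiv.addRight (Pi.single e 1))

/-- The operator `Z_e`, acting on the spin at `e` as `Z l_i = ω^i l_i`. -/
def siteZ (e : E) : StateSpace E d ≃ₗᵢ[ℂ] StateSpace E d :=
  LinearIsometryEquiv.piLpCongrRight 2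
    (fun k : E → ZMod d => (omega d ^ (k e).val) • LinearIsometryEquiv.refl ℂ ℂ)

theorem op_mul_apply (u w : StateSpace E d ≃ₗᵢ[ℂ] StateSpace E d) (ψ : StateSpace E d) :
    (u * w) ψ = u (w ψ) := rfl

theorem siteX_apply (e : E) (ψ : StateSpace E d) (k : E → ZMod d) :
    siteX e ψ k = ψ (k - Pi.single e 1) := by
  simp [siteX, LinearIsometryEquiv.piLpCongrLeft_apply, Equiv.piCongrLeft', sub_eq_add_neg]

theorem siteZ_apply (e : E) (ψ : StateSpace E d) (k : E → ZMod d) :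
    siteZ e ψ k = (omega d : ℂ) ^ (k e).val * ψ k := by
  simp [siteZ, LinearIsometryEquiv.piLpCongrRight_apply]

theorem siteX_productState (e : E) (k : E → ZMod d) :
    siteX e (productState k) = productState (k + Pi.single e 1) := by
  simp [siteX, productState]

theorem siteZ_productState (e : E) (k : E → ZMod d) :
    siteZ e (productState k) = (omega d : ℂ) ^ (k e).val • productState k := by
  ext k'
  rw [siteZ_apply]
  by_cases h : k' = k
  · subst h; simp [productState]
  · simp [productState, h]

theorem siteX_commute (e e' : E) :
    Commute (siteX e : StateSpace E d ≃ₗᵢ[ℂ] StateSpace E d) (siteX e') := by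
  ext ψ k
  simp only [op_mul_apply, siteX_apply, sub_right_comm]

theorem siteZ_commute (e e' : E) :
    Commute (siteZ e : StateSpace E d ≃ₗᵢ[ℂ] StateSpace E d) (siteZ e') := by
  ext ψ k
  simp only [op_mul_apply, siteZ_apply, mul_left_comm]

theorem siteX_pairwise (γ : E → ZMod d) (s : Set E) :
    s.Pairwise (Function.onFun Commute fun e =>
      (siteX e : StateSpace E d ≃ₗᵢ[ℂ] StateSpace E d) ^ (γ e).val) :=
  fun e _ e' _ _ => (siteX_commute e e').pow_pow _ _

/-- `X_γ = ∏_e X_e^{γ_e}` for a `1`-cochain `γ`. -/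
def opX (γ : E → ZMod d) : StateSpace E d ≃ₗᵢ[ℂ] StateSpace E d :=
  Finset.univ.noncommProd (fun e => siteX e ^ (γ e).val)
    (siteX_pairwise γ _)

theorem siteZ_pairwise (γ : E → ZMod d) (s : Set E) :
    s.Pairwise (Function.onFun Commute fun e =>
      (siteZ e : StateSpace E d ≃ₗᵢ[ℂ] StateSpace E d) ^ (γ e).val) :=
  fun e _ e' _ _ => (siteZ_commute e e').pow_pow _ _

/-- `Z_γ = ∏_e Z_e^{γ_e}` for a `1`-chain `γ`. -/
def opZ (γ : E → ZMod d) : StateSpace E d ≃ₗᵢ[ℂ] StateSpace E d :=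
  Finset.univ.noncommProd (fun e => siteZ e ^ (γ e).val)
    (siteZ_pairwise γ _)

theorem opX_apply (γ : E → ZMod d) (ψ : StateSpace E d) (k : E → ZMod d) :
    opX γ ψ k = ψ (k - γ) := by
  have hpow : ∀ (n : ℕ) (e : E) (φ : StateSpace E d) (k : E → ZMod d),
      (siteX e ^ n) φ k = φ (k - Pi.single e (n : ZMod d)) := by
    intro n e
    induction n with
    | zero => intro φ k; simp
    | succ n ih =>
      intro φ k
      rw [pow_succ, op_mul_apply, ih, siteX_apply]
      rw [sub_sub, ← Pi.single_add]
      push_cast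
      rfl
  have hs : ∀ (s : Finset E) (φ : StateSpace E d) (k : E → ZMod d),
      (s.noncommProd (fun e => siteX e ^ (γ e).val)
        (siteX_pairwise γ _) :
          StateSpace E d ≃ₗᵢ[ℂ] StateSpace E d) φ k
        = φ (k - ∑ e ∈ s, Pi.single e (γ e)) := by
    intro s
    induction s using Finset.induction_on with
    | empty => intro φ k; simp
    | insert a s ha ih =>
      intro φ k
      rw [Finset.noncommProd_insert_of_notMem _ _ _ _ ha, op_mul_apply, hpow, ih,
        Finset.sum_insert ha, sub_sub, ZMod.natCast_zmod_val]
  rw [opX, hs, Finset.univ_sum_single]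

theorem opZ_apply (γ : E → ZMod d) (ψ : StateSpace E d) (k : E → ZMod d) :
    opZ γ ψ k = (omega d : ℂ) ^ (∑ e, (k e).val * (γ e).val) * ψ k := by
  have hpow : ∀ (n : ℕ) (e : E) (φ : StateSpace E d) (k : E → ZMod d),
      (siteZ e ^ n) φ k = (omega d : ℂ) ^ ((k e).val * n) * φ k := by
    intro n e
    induction n with
    | zero => intro φ k; simp
    | succ n ih =>
      intro φ k
      rw [pow_succ, op_mul_apply, ih, siteZ_apply, ← mul_assoc, ← pow_add,
        mul_add_one]
  have hs : ∀ (s : Finset E) (φ : StateSpace E d) (k : E → ZMod d),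
      (s.noncommProd (fun e => siteZ e ^ (γ e).val)
        (siteZ_pairwise γ _) :
          StateSpace E d ≃ₗᵢ[ℂ] StateSpace E d) φ k
        = (omega d : ℂ) ^ (∑ e ∈ s, (k e).val * (γ e).val) * φ k := by
    intro s
    induction s using Finset.induction_on with
    | empty => intro φ k; simp
    | insert a s ha ih =>
      intro φ k
      rw [Finset.noncommProd_insert_of_notMem _ _ _ _ ha, op_mul_apply, hpow, ih,
        Finset.sum_insert ha, pow_add, mul_assoc]
  rw [opZ, hs]

/-- `X` as a homomorphism from the cochain group to the unitary operators. -/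
def opXHom : Multiplicative (E → ZMod d) →* (StateSpace E d ≃ₗᵢ[ℂ] StateSpace E d) where
  toFun γ := opX γ.toAdd
  map_one' := by ext ψ k; simp [opX_apply]
  map_mul' γ γ' := by
    ext ψ k
    simp [opX_apply, sub_sub, op_mul_apply]

/-- The average `(1/d) ∑_{j=0}^{d-1} u^j` of the powers of a unitary operator. -/
def powerAverage (u : StateSpace E d ≃ₗᵢ[ℂ] StateSpace E d) : Module.End ℂ (StateSpace E d) :=
  (1 / (d : ℂ)) • ∑ j ∈ Finset.range d, (u ^ j).toLinearEquiv.toLinearMap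

/-- The lowest eigenvalue of a Hamiltonian. -/
def groundEnergy (H : Module.End ℂ (StateSpace E d)) : ℝ :=
  sInf {x : ℝ | H.HasEigenvalue (x : ℂ)}

end Operators

namespace PolygonDecomposition

variable {V E F : Type*} (G : PolygonDecomposition V E F)
variable [Fintype E] [DecidableEq E] (d : ℕ) [NeZero d]

/-- `a_v = ∏_{e ∋ v} X_e^{ε(e)}`, with `ε(e) = 1` for incoming and `ε(e) = -1` for outgoing
edges. -/
def vertexUnitary [DecidableEq V] (v : V) : StateSpace E d ≃ₗᵢ[ℂ] StateSpace E d :=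
  opX (G.star d v)

/-- `b_f = ∏_{e ∈ f} Z_e^{ε(e)} = Z_{∂f}`. -/
def faceUnitary [DecidableEq F] (f : F) : StateSpace E d ≃ₗᵢ[ℂ] StateSpace E d :=
  opZ (G.faceBoundary d f)

/-- Kitaev's Hamiltonian `H_G = -∑_v A_v - ∑_f B_f`. -/
def hamiltonian [Fintype V] [Fintype F] [DecidableEq V] [DecidableEq F] :
    Module.End ℂ (StateSpace E d) :=
  -(∑ v, powerAverage (G.vertexUnitary d v)) - ∑ f, powerAverage (G.faceUnitary d f)

/-- The ground state space `S_G`: the eigenspace of `H_G` for its lowest eigenvalue. -/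
def groundStateSpace [Fintype V] [Fintype F] [DecidableEq V] [DecidableEq F] :
    Submodule ℂ (StateSpace E d) :=
  (G.hamiltonian d).eigenspace (groundEnergy (G.hamiltonian d) : ℂ)

/-- The group `K` generated by the operators `a_v`. -/
def vertexGroup [DecidableEq V] : Subgroup (StateSpace E d ≃ₗᵢ[ℂ] StateSpace E d) :=
  Subgroup.closure (Set.range (G.vertexUnitary d))

instance finite_vertexGroup [DecidableEq V] : Finite (G.vertexGroup d) := by
  have h : G.vertexGroup d ≤ (opXHom (E := E) (d := d)).range := by
    rw [vertexGroup, Subgroup.closure_le]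
    rintro _ ⟨v, rfl⟩
    exact ⟨Multiplicative.ofAdd (G.star d v), rfl⟩
  have : Finite (opXHom (E := E) (d := d)).range :=
    Set.finite_range (opXHom (E := E) (d := d))
  exact Finite.of_injective _ (Subgroup.inclusion_injective h)

instance fintype_vertexGroup [DecidableEq V] : Fintype (G.vertexGroup d) := Fintype.ofFinite _

/-- `Ψ₀ = |K|^{-1/2} ∑_{h ∈ K} h Ω`, with `Ω = ⨂_e l_0`. -/
def Psi₀ [DecidableEq V] : StateSpace E d :=
  (((Fintype.card (G.vertexGroup d) : ℝ) ^ (-(1 / 2) : ℝ) : ℝ) : ℂ) •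
    ∑ h : G.vertexGroup d, (h : StateSpace E d ≃ₗᵢ[ℂ] StateSpace E d) (productState 0)

end PolygonDecomposition

end KitaevModel

end

noncomputable section

namespace KitaevModel

/-! ### Stably free modules over semilocal rings and split complexes -/

/-! Cohomology. Fix a vertex `v₀` and a face `f₀`. Since the surface is connected, sums along paths
from `v₀` give a retraction of `coboundary₀` on the functions vanishing at `v₀`, and dual paths from
`f₀` give a section of `coboundary₁` followed by forgetting the value at `f₀`. Neither restriction
loses anything: constants have zero coboundary, and the values of `coboundary₁ c` sum to zero. So
the complex splits (`nonempty_H1_prod_linearEquiv`): `H1` plus a free module of rank (|V| - 1) +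
(|F| - 1) is free of rank |E|. As `ZMod d` is semilocal, `H1` is itself free, of rank 2g by Euler's
formula.

Ground states. Each `A_v` and `B_f` averages powers of a unitary, so its expectation is at most `‖ψ‖
^ 2`, with equality only when the unitary fixes `ψ`. Hence the energy is at least -(|V| + |F|), and
this value is attained exactly on the common fixed vectors of all `a_v` and `b_f`
(`hamiltonian_apply_eq_iff`). In the product basis `a_v` is translation by `star v` and `b_f` is a
diagonal phase given by the value of `coboundary₁` at `f`, so the fixed vectors are the functions on
cocycles that are invariant under coboundaries, that is, functions on `H1` (`fixed_iff`). `Psi₀` is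
the normalized indicator of the coboundaries and `opX γ` translates it to the coset of `γ`; the
normalized indicators of the cosets form an orthonormal basis of these functions. -/

open TensorProduct in
/-- Over a semilocal ring a stably free module is free. -/
theorem nonempty_basis_of_stablyFree {R M α β : Type*} [CommRing R] [Finite (MaximalSpectrum R)]
    [AddCommGroup M] [Module R M] [Fintype α] [Fintype β]
    (e : (M × (α → R)) ≃ₗ[R] (β → R)) (n : ℕ) (h : Fintype.card β = n + Fintype.card α) :
    Nonempty (Module.Basis (Fin n) R M) := by
  have hproj : Module.Projective R M :=
    Module.Projective.of_split (e.toLinearMap ∘ₗ LinearMap.inl R M (α → R))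
      (LinearMap.fst R M (α → R) ∘ₗ e.symm.toLinearMap) (by ext; simp)
  have hfin : Module.Finite R M :=
    Module.Finite.of_surjective (LinearMap.fst R M (α → R) ∘ₗ e.symm.toLinearMap)
      (Prod.fst_surjective.comp e.symm.surjective)
  -- Over a semilocal ring, a finite flat module is free once its fibres at all maximal ideals have
  -- the same dimension. Tensoring `e` with `R ⧸ P` shows that this dimension is `n` for every `P`.
  refine Module.nonempty_basis_of_flat_of_finrank_eq R M n fun P => ?_
  let := Ideal.Quotient.field P.1
  have h1 := (e.baseChange R (R ⧸ P.1) _ _).finrank_eq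
  have h2 := (TensorProduct.prodRight R (R ⧸ P.1) (R ⧸ P.1) M (α → R)).finrank_eq
  have : Nontrivial R := Module.nontrivial R (R ⧸ P.1)
  have h3 : Module.finrank (R ⧸ P.1) ((R ⧸ P.1) ⊗[R] (α → R)) = Fintype.card α := by
    rw [Module.finrank_baseChange, Module.finrank_fintype_fun_eq_card]
  have h4 : Module.finrank (R ⧸ P.1) ((R ⧸ P.1) ⊗[R] (β → R)) = Fintype.card β := by
    rw [Module.finrank_baseChange, Module.finrank_fintype_fun_eq_card]
  rw [h2, Module.finrank_prod, h3, h4] at h1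
  omega

/-- A complex `P → X → Q` whose first map has a retraction and whose second map has a section
splits. -/
theorem nonempty_linearEquiv_of_split {R X P Q : Type*} [Ring R] [AddCommGroup X] [Module R X]
    [AddCommGroup P] [Module R P] [AddCommGroup Q] [Module R Q]
    {ι : P →ₗ[R] X} {ρ : X →ₗ[R] P} {π : X →ₗ[R] Q} {σ : Q →ₗ[R] X}
    (hρ : ∀ p, ρ (ι p) = p) (hσ : ∀ q, π (σ q) = q) (h : ∀ p, π (ι p) = 0)
    {Z B : Submodule R X} (hZ : LinearMap.ker π = Z) (hB : LinearMap.range ι = B) :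
    Nonempty (((Z ⧸ B.submoduleOf Z) × (P × Q)) ≃ₗ[R] X) := by
  subst hZ hB
  -- The projection onto `ker π` along the range of `σ`.
  let τ : X →ₗ[R] LinearMap.ker π :=
    (LinearMap.id - σ ∘ₗ π).codRestrict _ fun x => by simp [hσ]
  have hτ : ∀ x, (τ x : X) = x - σ (π x) := fun x => rfl
  let Φ := (Submodule.mkQ ((LinearMap.range ι).submoduleOf (LinearMap.ker π)) ∘ₗ τ).prod
    ((ρ ∘ₗ (LinearMap.ker π).subtype ∘ₗ τ).prod π)
  refine ⟨(LinearEquiv.ofBijective Φ ⟨?_, ?_⟩).symm⟩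
  · refine (injective_iff_map_eq_zero Φ).2 fun x hx => ?_
    obtain ⟨h1, h2⟩ := Prod.mk_eq_zero.1 hx
    obtain ⟨h2, h3⟩ := Prod.mk_eq_zero.1 h2
    obtain ⟨p, hp⟩ := (Submodule.Quotient.mk_eq_zero _).1 h1
    change ρ (τ x : X) = 0 at h2
    change ι p = (τ x : X) at hp
    rw [hτ] at hp h2
    rw [h3, map_zero, sub_zero] at hp h2
    rw [← hp, hρ] at h2
    rw [← hp, h2, map_zero]
  · rintro ⟨y, p, q⟩
    obtain ⟨z, rfl⟩ := Submodule.Quotient.mk_surjective _ y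
    have hz : π z = 0 := z.2
    -- `z - ι (ρ z)` has the class of `z` and is killed by `ρ`; adding `ι p` changes only the
    -- `P`-coordinate, and `σ q` only the `Q`-coordinate, since `τ` removes it.
    refine ⟨z - ι (ρ z) + ι p + σ q, ?_⟩
    have hπ : π (z - ι (ρ z) + ι p + σ q) = q := by simp [h, hσ, hz]
    refine Prod.ext ((Submodule.Quotient.eq _).2 ?_) (Prod.ext ?_ hπ)
    swap
    · change ρ (τ _ : X) = p
      rw [hτ, hπ]
      simp [hρ]
    refine ⟨p - ρ z, ?_⟩
    change ι (p - ρ z) = (τ _ : X) - z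
    rw [hτ, hπ, map_sub]
    abel

namespace PolygonDecomposition

/-! ### Cohomology of a polygon decomposition -/

variable {V E F : Type*} (G : PolygonDecomposition V E F)

theorem org_rot (x : E × Bool) : G.org (G.rot x) = G.org x :=
  (G.org_eq_iff _ _).2 (Equiv.Perm.sameCycle_apply_left.2 (Equiv.Perm.SameCycle.refl _ _))

/-- The face permutation takes `dartRev (rot x)` to `x`. Thus one rotation step around a vertex
crosses exactly the edge of `rot x`. -/
theorem left_dartRev_rot (x : E × Bool) : G.left (dartRev E (G.rot x)) = G.left x := by
  refine (G.left_eq_iff _ _).2 ⟨1, ?_⟩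
  simp [dartRev]

/-- An equivalence relation on the darts is everything as soon as it contains the pairs
`(x, rot x)` and `(x, dartRev x)`. -/
theorem dart_induction (r : Setoid (E × Bool)) (hrot : ∀ x, r x (G.rot x))
    (hrev : ∀ x, r x (dartRev E x)) (x y : E × Bool) : r x y := by
  obtain ⟨w, hw, rfl⟩ := G.connected x y
  induction hw using Subgroup.closure_induction generalizing x with
  | mem w hw =>
    rcases hw with rfl | rfl
    exacts [hrot x, hrev x]
  | one => exact r.refl x
  | mul a b _ _ ha hb => exact r.trans (hb x) (ha (b x))
  | inv a _ ha =>
    have := ha (a⁻¹ x)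
    rw [← Equiv.Perm.mul_apply, mul_inv_cancel] at this
    exact r.symm this

variable (d : ℕ)

theorem coboundary₀_apply [Fintype V] [DecidableEq V] (u : V → ZMod d) (e : E) :
    G.coboundary₀ d u e = u (G.tgt e) - u (G.src e) := by
  simp [coboundary₀, star, mul_sub, Finset.sum_sub_distrib]

theorem coboundary₁_apply [Fintype E] [DecidableEq F] (c : E → ZMod d) (f : F) :
    G.coboundary₁ d c f = ∑ e, c e * G.faceBoundary d f e := rfl

theorem coboundary₁_single [Fintype E] [DecidableEq E] [DecidableEq F] (e : E) :
    G.coboundary₁ d (Pi.single e 1)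
      = Pi.single (G.left (e, true)) 1 - Pi.single (G.left (e, false)) 1 := by
  ext f
  simp [coboundary₁_apply, Pi.single_apply, faceBoundary, eq_comm (a := f)]

/-- Each edge counts once with sign + for the face on its left and once with sign - for the face on
its right. -/
theorem sum_coboundary₁ [Fintype E] [Fintype F] [DecidableEq F] (c : E → ZMod d) :
    ∑ f, G.coboundary₁ d c f = 0 := by
  simp only [coboundary₁_apply]
  rw [Finset.sum_comm]
  simp [← Finset.mul_sum, faceBoundary]

/-- The sum along a path from `v` to `w`. -/
theorem exists_vertex_path [Fintype V] [DecidableEq V] (v w : V) :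
    ∃ φ : (E → ZMod d) →ₗ[ZMod d] ZMod d, ∀ u, φ (G.coboundary₀ d u) = u w - u v := by
  obtain ⟨x, rfl⟩ := G.org_surjective v
  obtain ⟨y, rfl⟩ := G.org_surjective w
  let r : Setoid (E × Bool) :=
    { r := fun x y => ∃ φ : (E → ZMod d) →ₗ[ZMod d] ZMod d,
        ∀ u, φ (G.coboundary₀ d u) = u (G.org y) - u (G.org x)
      iseqv :=
        { refl := fun x => ⟨0, fun u => by simp⟩
          symm := fun ⟨φ, h⟩ => ⟨-φ, fun u => by simp [h]⟩
          trans := fun ⟨φ, h⟩ ⟨φ', h'⟩ => ⟨φ + φ', fun u => by simp [h, h']⟩ } }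
  refine G.dart_induction r (fun x => ⟨0, fun u => by simp [org_rot]⟩) ?_ x y
  rintro ⟨e, _ | _⟩
  · exact ⟨-LinearMap.proj e, fun u => by simp [coboundary₀_apply, dartRev, src, tgt]⟩
  · exact ⟨LinearMap.proj e, fun u => by simp [coboundary₀_apply, dartRev, src, tgt]⟩

/-- The cochain of the edges crossed by a path in the dual decomposition from `f` to `f'`. -/
theorem exists_face_path [Fintype E] [DecidableEq F] (f f' : F) :
    ∃ c : E → ZMod d, G.coboundary₁ d c = Pi.single f' 1 - Pi.single f 1 := by
  classical
  obtain ⟨x, rfl⟩ := G.left_surjective f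
  obtain ⟨y, rfl⟩ := G.left_surjective f'
  let r : Setoid (E × Bool) :=
    { r := fun x y => ∃ c : E → ZMod d,
        G.coboundary₁ d c = Pi.single (G.left y) 1 - Pi.single (G.left x) 1
      iseqv :=
        { refl := fun x => ⟨0, by simp⟩
          symm := fun ⟨c, h⟩ => ⟨-c, by simp [h]⟩
          trans := fun ⟨c, h⟩ ⟨c', h'⟩ => ⟨c + c', by simp [h, h']⟩ } }
  have hrev : ∀ x, r x (dartRev E x) := by
    rintro ⟨e, _ | _⟩
    · exact ⟨Pi.single e 1, by simp [coboundary₁_single, dartRev]⟩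
    · exact ⟨-Pi.single e 1, by simp [coboundary₁_single, dartRev]⟩
  refine G.dart_induction r (fun x => ?_) hrev x y
  -- The detour through `dartRev (rot x)` first stays in the face of `x`, at no cost, then crosses
  -- one edge.
  refine r.trans (b := dartRev E (G.rot x)) ⟨0, ?_⟩ (r.symm (hrev (G.rot x)))
  rw [left_dartRev_rot, sub_self, map_zero]

variable [Fintype V] [Fintype E] [DecidableEq V] [DecidableEq F]

theorem coboundary₁_coboundary₀ (u : V → ZMod d) : G.coboundary₁ d (G.coboundary₀ d u) = 0 :=
  LinearMap.mem_ker.1 (G.coboundaries_le_cocycles d (LinearMap.mem_range_self _ u))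

variable [Fintype F]

/-- The cochain complex splits. -/
theorem nonempty_H1_prod_linearEquiv (v₀ : V) (f₀ : F) :
    Nonempty ((G.H1 d × (({v // v ≠ v₀} → ZMod d) × ({f // f ≠ f₀} → ZMod d)))
      ≃ₗ[ZMod d] (E → ZMod d)) := by
  choose φ hφ using G.exists_vertex_path d v₀
  choose c hc using G.exists_face_path d f₀
  let ext₀ : ({v // v ≠ v₀} → ZMod d) →ₗ[ZMod d] (V → ZMod d) :=
    Function.ExtendByZero.linearMap (ZMod d) Subtype.val
  have hext : ∀ p v, ext₀ p v = if h : v ≠ v₀ then p ⟨v, h⟩ else 0 := by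
    intro p v
    by_cases h : v ≠ v₀
    · rw [dif_pos h]
      exact Subtype.val_injective.extend_apply p 0 ⟨v, h⟩
    · rw [dif_neg h]
      exact Function.extend_apply' _ _ _ fun ⟨w, hw⟩ => h (hw ▸ w.2)
  refine nonempty_linearEquiv_of_split (ι := G.coboundary₀ d ∘ₗ ext₀)
    (ρ := LinearMap.pi fun v => φ v)
    (π := LinearMap.funLeft (ZMod d) (ZMod d) Subtype.val ∘ₗ G.coboundary₁ d)
    (σ := Fintype.linearCombination (ZMod d) (fun f : {f // f ≠ f₀} => c f))
    (fun p => ?_) (fun q => ?_) (fun p => ?_) ?_ ?_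
  · ext v
    simp [hφ, hext, v.2]
  · ext f
    simp only [LinearMap.comp_apply, Fintype.linearCombination_apply, map_sum, map_smul, hc]
    simp [LinearMap.funLeft_apply, Finset.sum_apply, Pi.single_apply, f.2,
      Subtype.val_inj]
  · simp [coboundary₁_coboundary₀]
  -- The coordinate at `f₀` is minus the sum of the others, so a cochain is a cocycle once its
  -- coboundary vanishes off `f₀`.
  · ext x
    rw [cocycles, LinearMap.mem_ker, LinearMap.mem_ker]
    constructor
    · intro h
      have h1 : ∀ f, f ≠ f₀ → G.coboundary₁ d x f = 0 := fun f hf => congrFun h ⟨f, hf⟩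
      ext f
      by_cases hf : f = f₀
      · have h2 := G.sum_coboundary₁ d x
        rw [Finset.sum_eq_single f₀ (fun f _ hf => h1 f hf) (by simp)] at h2
        rw [hf, h2, Pi.zero_apply]
      · exact h1 f hf
    · intro h
      rw [LinearMap.comp_apply, h, map_zero]
  · refine le_antisymm (LinearMap.range_comp_le_range _ _) ?_
    rintro _ ⟨u, rfl⟩
    -- Subtracting a constant leaves the coboundary unchanged and makes `u` vanish at `v₀`.
    refine ⟨fun v => u v - u v₀, ?_⟩
    ext e
    have h : ∀ v, ext₀ (fun v => u v - u v₀) v = u v - u v₀ := by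
      intro v
      rw [hext]
      split_ifs with h
      · rfl
      · rw [not_not.1 h, sub_self]
    rw [LinearMap.comp_apply, coboundary₀_apply, coboundary₀_apply, h, h]
    ring

/-- The first cohomology group of a closed surface of genus `g` is free of rank `2g`. -/
theorem nonempty_addEquiv_H1 {g : ℕ} (hg : G.HasGenus g) [NeZero d] :
    Nonempty (((Fin g → ZMod d) × (Fin g → ZMod d)) ≃+ G.H1 d) := by
  obtain ⟨e₀⟩ := G.nonempty
  have v₀ := G.org (e₀, true)
  have f₀ := G.left (e₀, true)
  obtain ⟨e⟩ := G.nonempty_H1_prod_linearEquiv d v₀ f₀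
  have hV : 0 < Fintype.card V := Fintype.card_pos_iff.2 ⟨v₀⟩
  have hF : 0 < Fintype.card F := Fintype.card_pos_iff.2 ⟨f₀⟩
  -- Euler's formula rewritten as |E| = 2g + (|V| - 1) + (|F| - 1).
  have hcard : Fintype.card E
      = (g + g) + Fintype.card ({v : V // v ≠ v₀} ⊕ {f : F // f ≠ f₀}) := by
    rw [Fintype.card_sum, Fintype.card_subtype_compl, Fintype.card_subtype_compl,
      Fintype.card_subtype_eq, Fintype.card_subtype_eq]
    rw [HasGenus] at hg
    omega
  -- A finite ring has finitely many ideals, hence is semilocal.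
  have : Finite (Ideal (ZMod d)) := Finite.of_injective _ SetLike.coe_injective
  have : Finite (MaximalSpectrum (ZMod d)) :=
    Finite.of_injective MaximalSpectrum.asIdeal fun _ _ => MaximalSpectrum.ext
  obtain ⟨b⟩ := nonempty_basis_of_stablyFree
    ((LinearEquiv.prodCongr (LinearEquiv.refl _ _)
      (LinearEquiv.sumArrowLequivProdArrow _ _ (ZMod d) (ZMod d))).trans e) _ hcard
  exact ⟨((b.reindex finSumFinEquiv.symm).equivFun.trans
    (LinearEquiv.sumArrowLequivProdArrow _ _ (ZMod d) (ZMod d))).symm.toAddEquiv⟩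

end PolygonDecomposition

/-! ### Averages of the powers of a unitary operator -/

theorem omega_pow_eq_one_iff (d : ℕ) [NeZero d] (n : ℕ) :
    (omega d : ℂ) ^ n = 1 ↔ (n : ZMod d) = 0 := by
  rw [ZMod.natCast_eq_zero_iff]
  exact (Complex.isPrimitiveRoot_exp d (NeZero.ne d)).pow_eq_one_iff_dvd n

section Operators

variable {E : Type*} [Fintype E] [DecidableEq E] {d : ℕ} [NeZero d]

theorem opX_productState (γ k : E → ZMod d) :
    opX γ (productState k) = productState (k + γ) := by
  ext k'
  simp [opX_apply, productState, PiLp.single_apply, sub_eq_iff_eq_add]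

theorem productState_injective :
    Function.Injective (productState : (E → ZMod d) → StateSpace E d) := by
  intro k k' h
  have h1 := congrArg (fun ψ : StateSpace E d => ψ k) h
  by_contra hne
  simp [productState, hne] at h1

theorem opX_injective : Function.Injective (opX : (E → ZMod d) → _) := by
  intro γ γ' h
  have h1 := congrArg (fun u : StateSpace E d ≃ₗᵢ[ℂ] StateSpace E d => u (productState 0)) h
  simp only [opX_productState, zero_add] at h1
  exact productState_injective h1

theorem opX_pow_card (γ : E → ZMod d) : opX γ ^ d = 1 := by
  have h := map_pow (opXHom (E := E) (d := d)) (Multiplicative.ofAdd γ) d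
  rw [← ofAdd_nsmul] at h
  have h0 : d • γ = 0 := by ext; simp
  rw [h0, ofAdd_zero, map_one] at h
  exact h.symm

theorem opZ_pow_card (γ : E → ZMod d) : opZ γ ^ d = 1 := by
  have hpow : ∀ (n : ℕ) (ψ : StateSpace E d) (k : E → ZMod d), (opZ γ ^ n) ψ k
      = (omega d : ℂ) ^ (n * ∑ e, (k e).val * (γ e).val) * ψ k := by
    intro n
    induction n with
    | zero => intro ψ k; simp
    | succ n ih =>
      intro ψ k
      rw [pow_succ, op_mul_apply, ih, opZ_apply, ← mul_assoc, ← pow_add, add_one_mul]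
  ext ψ k
  rw [hpow, (omega_pow_eq_one_iff d _).2 (by simp), one_mul]
  rfl

theorem re_inner_isometry_le (u : StateSpace E d ≃ₗᵢ[ℂ] StateSpace E d) (ψ : StateSpace E d) :
    (inner ℂ ψ (u ψ)).re ≤ ‖ψ‖ ^ 2 := by
  have h := re_inner_le_norm (𝕜 := ℂ) ψ (u ψ)
  rwa [u.norm_map, ← sq] at h

/-- Equality case of Cauchy-Schwarz: `‖ψ - u ψ‖ ^ 2` equals twice `‖ψ‖ ^ 2` minus the real part of
the inner product, hence is at most zero. -/
theorem eq_of_le_re_inner_isometry {u : StateSpace E d ≃ₗᵢ[ℂ] StateSpace E d}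
    {ψ : StateSpace E d} (h : ‖ψ‖ ^ 2 ≤ (inner ℂ ψ (u ψ)).re) : u ψ = ψ := by
  have h1 := norm_sub_sq (𝕜 := ℂ) ψ (u ψ)
  rw [u.norm_map] at h1
  change _ = _ - 2 * (inner ℂ ψ (u ψ)).re + _ at h1
  have h2 : ‖ψ - u ψ‖ = 0 := by
    have := sq_nonneg ‖ψ - u ψ‖
    exact pow_eq_zero_iff two_ne_zero |>.1 (by linarith)
  exact (sub_eq_zero.1 (norm_eq_zero.1 h2)).symm

theorem powerAverage_apply (u : StateSpace E d ≃ₗᵢ[ℂ] StateSpace E d) (ψ : StateSpace E d) :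
    powerAverage u ψ = (1 / (d : ℂ)) • ∑ j ∈ Finset.range d, (u ^ j) ψ := by
  simp [powerAverage]

theorem powerAverage_apply_of_fixed {u : StateSpace E d ≃ₗᵢ[ℂ] StateSpace E d}
    {ψ : StateSpace E d} (h : u ψ = ψ) : powerAverage u ψ = ψ := by
  have hj : ∀ j : ℕ, (u ^ j) ψ = ψ := by
    intro j
    induction j with
    | zero => rfl
    | succ j ih => rw [pow_succ, op_mul_apply, h, ih]
  have hd : (d : ℂ) ≠ 0 := NeZero.ne _
  rw [powerAverage_apply, Finset.sum_congr rfl fun j _ => hj j, Finset.sum_const,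
    Finset.card_range, ← Nat.cast_smul_eq_nsmul ℂ, smul_smul, one_div, inv_mul_cancel₀ hd, one_smul]

theorem card_mul_re_inner_powerAverage (u : StateSpace E d ≃ₗᵢ[ℂ] StateSpace E d)
    (ψ : StateSpace E d) : d * (inner ℂ ψ (powerAverage u ψ)).re
      = ∑ j ∈ Finset.range d, (inner ℂ ψ ((u ^ j) ψ)).re := by
  have hd : (d : ℂ) ≠ 0 := NeZero.ne _
  rw [powerAverage_apply, inner_smul_right, inner_sum, ← Complex.re_sum,
    ← Complex.re_ofReal_mul, ← mul_assoc]
  push_cast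
  rw [mul_one_div_cancel hd, one_mul]

theorem re_inner_powerAverage_le (u : StateSpace E d ≃ₗᵢ[ℂ] StateSpace E d)
    (ψ : StateSpace E d) : (inner ℂ ψ (powerAverage u ψ)).re ≤ ‖ψ‖ ^ 2 := by
  have hd : (0 : ℝ) < d := Nat.cast_pos.2 (NeZero.pos d)
  refine le_of_mul_le_mul_left ?_ hd
  rw [card_mul_re_inner_powerAverage]
  refine (Finset.sum_le_card_nsmul _ _ _ fun j _ => re_inner_isometry_le (u ^ j) ψ).trans_eq ?_
  simp

/-- An average of `d` terms, each at most `‖ψ‖ ^ 2`, reaches this bound only if every term does; the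
term `j = 1` then gives the claim. -/
theorem fixed_of_le_re_inner_powerAverage {u : StateSpace E d ≃ₗᵢ[ℂ] StateSpace E d}
    (hu : u ^ d = 1) {ψ : StateSpace E d}
    (h : ‖ψ‖ ^ 2 ≤ (inner ℂ ψ (powerAverage u ψ)).re) : u ψ = ψ := by
  -- For `d = 1` the average has no term `j = 1`, but then `u ^ d = 1` says `u = 1`.
  rcases (Nat.one_le_iff_ne_zero.2 (NeZero.ne d)).eq_or_lt with h1 | h1
  · obtain rfl : u = 1 := by rw [← pow_one u, ← hu]; congr 1
    rfl
  have hsum : ∑ j ∈ Finset.range d, (inner ℂ ψ ((u ^ j) ψ)).re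
      = ∑ _j ∈ Finset.range d, ‖ψ‖ ^ 2 := by
    rw [← card_mul_re_inner_powerAverage, Finset.sum_const, Finset.card_range, nsmul_eq_mul,
      le_antisymm (re_inner_powerAverage_le u ψ) h]
  have h2 := (Finset.sum_eq_sum_iff_of_le fun j _ => re_inner_isometry_le (u ^ j) ψ).1 hsum 1
    (Finset.mem_range.2 h1)
  rw [pow_one] at h2
  exact eq_of_le_re_inner_isometry h2.ge

end Operators

namespace PolygonDecomposition

/-! ### The ground states -/

variable {V E F : Type*} (G : PolygonDecomposition V E F)
variable [Fintype E] [DecidableEq E] (d : ℕ) [NeZero d]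

variable {d} in
theorem vertexUnitary_fixed_iff [DecidableEq V] {v : V} {ψ : StateSpace E d} :
    G.vertexUnitary d v ψ = ψ ↔ ∀ k, ψ (k - G.star d v) = ψ k := by
  rw [PiLp.ext_iff]
  simp only [vertexUnitary, opX_apply]

-- `b_f` multiplies the amplitude at `k` by `ω` to the power `coboundary₁ k f`, which is 1 only if
-- the exponent vanishes mod `d`, because `ω` is a primitive `d`-th root of unity.
variable {d} in
theorem faceUnitary_fixed_iff [DecidableEq F] {f : F} {ψ : StateSpace E d} :
    G.faceUnitary d f ψ = ψ ↔ ∀ k, G.coboundary₁ d k f ≠ 0 → ψ k = 0 := by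
  rw [PiLp.ext_iff]
  refine forall_congr' fun k => ?_
  have h : G.coboundary₁ d k f
      = ((∑ e, (k e).val * (G.faceBoundary d f e).val : ℕ) : ZMod d) := by
    simp [coboundary₁_apply]
  rw [faceUnitary, opZ_apply, mul_left_eq_self₀, h, ne_eq, ← omega_pow_eq_one_iff]
  tauto

/-! ### The group `K` as the group of coboundaries, and the state `Psi₀`. -/

variable [Fintype V] [DecidableEq V]

omit [Fintype E] [DecidableEq E] [NeZero d] in
theorem star_mem_coboundaries (v : V) : G.star d v ∈ G.coboundaries d :=
  ⟨Pi.single v 1, by simp [coboundary₀, Pi.single_apply]⟩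

-- Coefficients in `ZMod d` are casts of natural numbers, so the stars generate the coboundaries
-- already as an additive group.
variable {d} in
omit [Fintype E] [DecidableEq E] in
theorem mem_of_mem_coboundaries {S : AddSubgroup (E → ZMod d)} (hS : ∀ v, G.star d v ∈ S)
    {b : E → ZMod d} (hb : b ∈ G.coboundaries d) : b ∈ S := by
  obtain ⟨u, rfl⟩ := hb
  refine S.sum_mem fun v _ => ?_
  rw [← ZMod.natCast_zmod_val (u v), Nat.cast_smul_eq_nsmul]
  exact S.nsmul_mem (hS v) _

-- `opX` is an injective homomorphism on cochains taking `star v` to `a_v`, so it identifies the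
-- coboundaries with `K`.
variable {d} in
theorem opX_mem_vertexGroup_iff {γ : E → ZMod d} :
    opX γ ∈ G.vertexGroup d ↔ γ ∈ G.coboundaries d := by
  constructor
  · intro h
    have hle : G.vertexGroup d ≤ (AddSubgroup.toSubgroup
        (G.coboundaries d).toAddSubgroup).map (opXHom (E := E) (d := d)) := by
      rw [vertexGroup, Subgroup.closure_le]
      rintro _ ⟨v, rfl⟩
      exact ⟨Multiplicative.ofAdd (G.star d v), G.star_mem_coboundaries d v, rfl⟩
    obtain ⟨b, hb, hbγ⟩ := hle h
    have : Multiplicative.toAdd b = γ := opX_injective hbγ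
    exact this ▸ hb
  · intro h
    let S : AddSubgroup (E → ZMod d) :=
      Subgroup.toAddSubgroup' ((G.vertexGroup d).comap (opXHom (E := E) (d := d)))
    exact G.mem_of_mem_coboundaries (S := S) (fun v => Subgroup.subset_closure ⟨v, rfl⟩) h

variable {d} in
omit [Fintype V] in
theorem exists_opX_eq_of_mem_vertexGroup {h : StateSpace E d ≃ₗᵢ[ℂ] StateSpace E d}
    (hh : h ∈ G.vertexGroup d) : ∃ γ, opX γ = h := by
  have hle : G.vertexGroup d ≤ (opXHom (E := E) (d := d)).range := by
    rw [vertexGroup, Subgroup.closure_le]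
    rintro _ ⟨v, rfl⟩
    exact ⟨Multiplicative.ofAdd (G.star d v), rfl⟩
  obtain ⟨γ, hγ⟩ := hle hh
  exact ⟨γ.toAdd, hγ⟩

theorem card_vertexGroup :
    Nat.card (G.coboundaries d) = Fintype.card (G.vertexGroup d) := by
  rw [← Nat.card_eq_fintype_card]
  refine Nat.card_congr (Equiv.ofBijective
    (fun b => ⟨opX b.1, G.opX_mem_vertexGroup_iff.2 b.2⟩) ⟨fun b b' h => ?_, fun h => ?_⟩)
  · exact Subtype.ext (opX_injective (congrArg Subtype.val h))
  · obtain ⟨γ, hγ⟩ := G.exists_opX_eq_of_mem_vertexGroup h.2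
    exact ⟨⟨γ, G.opX_mem_vertexGroup_iff.1 (hγ ▸ h.2)⟩, Subtype.ext hγ⟩

/-- The normalization constant of `Ψ₀`. -/
def normConst : ℝ := (Fintype.card (G.vertexGroup d) : ℝ) ^ (-(1 / 2) : ℝ)

omit [Fintype V] in
theorem normConst_pos : 0 < G.normConst d :=
  Real.rpow_pos_of_pos (Nat.cast_pos.2 Fintype.card_pos) _

theorem card_mul_normConst_sq : (Nat.card (G.coboundaries d) : ℝ) * G.normConst d ^ 2 = 1 := by
  have h : (0 : ℝ) < Fintype.card (G.vertexGroup d) := Nat.cast_pos.2 Fintype.card_pos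
  rw [card_vertexGroup, normConst, ← Real.rpow_natCast, ← Real.rpow_mul h.le]
  norm_num
  rw [Real.rpow_neg_one, mul_inv_cancel₀ h.ne']

-- An element `opX γ` of `K` moves `Ω` to the basis vector at `γ`, so the sum over `K` is the
-- indicator of the coboundaries.
open Classical in
theorem Psi₀_apply (k : E → ZMod d) :
    G.Psi₀ d k = if k ∈ G.coboundaries d then (G.normConst d : ℂ) else 0 := by
  have h1 : ∀ h : G.vertexGroup d,
      (h : StateSpace E d ≃ₗᵢ[ℂ] StateSpace E d) (productState 0) k
        = if opX k = (h : StateSpace E d ≃ₗᵢ[ℂ] StateSpace E d) then 1 else 0 := by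
    intro h
    obtain ⟨γ, hγ⟩ := G.exists_opX_eq_of_mem_vertexGroup h.2
    rw [← hγ, opX_productState, opX_injective.eq_iff, productState, PiLp.single_apply, zero_add]
    congr
  have h2 : G.Psi₀ d k = G.normConst d * ∑ h : G.vertexGroup d,
      (h : StateSpace E d ≃ₗᵢ[ℂ] StateSpace E d) (productState 0) k := by
    simp [Psi₀, normConst]
  rw [h2, Finset.sum_congr rfl fun h _ => h1 h]
  split_ifs with hk
  · rw [← opX_mem_vertexGroup_iff] at hk
    rw [Finset.sum_eq_single ⟨opX k, hk⟩, if_pos rfl, mul_one]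
    · exact fun h _ hne => if_neg fun heq => hne (Subtype.ext heq.symm)
    · simp
  · rw [Finset.sum_eq_zero, mul_zero]
    exact fun h _ => if_neg fun heq => hk (G.opX_mem_vertexGroup_iff.1 (heq ▸ h.2))

theorem norm_Psi₀ : ‖G.Psi₀ d‖ = 1 := by
  classical
  have h : ‖G.Psi₀ d‖ ^ 2 = 1 := by
    have h1 : ∀ k, ‖G.Psi₀ d k‖ ^ 2
        = if k ∈ G.coboundaries d then G.normConst d ^ 2 else 0 := by
      intro k
      rw [Psi₀_apply]
      split_ifs <;> simp
    rw [EuclideanSpace.norm_sq_eq, Finset.sum_congr rfl fun k _ => h1 k, Finset.sum_ite,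
      Finset.sum_const_zero, add_zero, Finset.sum_const, ← Fintype.card_subtype, nsmul_eq_mul,
      ← Nat.card_eq_fintype_card]
    exact G.card_mul_normConst_sq d
  exact (pow_eq_one_iff_of_nonneg (norm_nonneg _) two_ne_zero).1 h

/-! ### The lowest energy and its eigenvectors. -/

variable [Fintype F] [DecidableEq F]

variable {d} in
theorem re_inner_hamiltonian (ψ : StateSpace E d) :
    (inner ℂ ψ (G.hamiltonian d ψ)).re
      = -(∑ v, (inner ℂ ψ (powerAverage (G.vertexUnitary d v) ψ)).re
        + ∑ f, (inner ℂ ψ (powerAverage (G.faceUnitary d f) ψ)).re) := by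
  simp [hamiltonian, inner_sum, inner_neg_right]
  ring

variable {d} in
theorem le_re_inner_hamiltonian (ψ : StateSpace E d) :
    -(Fintype.card V + Fintype.card F : ℝ) * ‖ψ‖ ^ 2 ≤ (inner ℂ ψ (G.hamiltonian d ψ)).re := by
  rw [re_inner_hamiltonian, neg_mul, neg_le_neg_iff, add_mul]
  refine add_le_add
    ((Finset.sum_le_card_nsmul _ _ _ fun v _ => re_inner_powerAverage_le _ ψ).trans_eq ?_)
    ((Finset.sum_le_card_nsmul _ _ _ fun v _ => re_inner_powerAverage_le _ ψ).trans_eq ?_)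
  all_goals simp

-- The energy bound is a sum of |V| + |F| termwise bounds, so it is saturated only if each of them
-- is.
variable {d} in
theorem hamiltonian_apply_eq_iff {ψ : StateSpace E d} :
    G.hamiltonian d ψ = ((-(Fintype.card V + Fintype.card F : ℝ) : ℝ) : ℂ) • ψ
      ↔ (∀ v, G.vertexUnitary d v ψ = ψ) ∧ ∀ f, G.faceUnitary d f ψ = ψ := by
  constructor
  · intro h
    have h1 := G.re_inner_hamiltonian ψ
    rw [h, inner_smul_right, Complex.re_ofReal_mul] at h1
    have h0 : (inner ℂ ψ ψ).re = ‖ψ‖ ^ 2 := inner_self_eq_norm_sq (𝕜 := ℂ) ψ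
    have hV : ∀ v ∈ Finset.univ, (inner ℂ ψ (powerAverage (G.vertexUnitary d v) ψ)).re ≤ ‖ψ‖ ^ 2 :=
      fun v _ => re_inner_powerAverage_le _ ψ
    have hF : ∀ f ∈ Finset.univ, (inner ℂ ψ (powerAverage (G.faceUnitary d f) ψ)).re ≤ ‖ψ‖ ^ 2 :=
      fun f _ => re_inner_powerAverage_le _ ψ
    have sV := Finset.sum_le_sum hV
    have sF := Finset.sum_le_sum hF
    have cV : ∑ _v : V, ‖ψ‖ ^ 2 = Fintype.card V * ‖ψ‖ ^ 2 := by simp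
    have cF : ∑ _f : F, ‖ψ‖ ^ 2 = Fintype.card F * ‖ψ‖ ^ 2 := by simp
    rw [h0] at h1
    constructor
    · intro v
      refine fixed_of_le_re_inner_powerAverage (opX_pow_card _)
        ((Finset.sum_eq_sum_iff_of_le hV).1 ?_ v (Finset.mem_univ v)).ge
      linarith
    · intro f
      refine fixed_of_le_re_inner_powerAverage (opZ_pow_card _)
        ((Finset.sum_eq_sum_iff_of_le hF).1 ?_ f (Finset.mem_univ f)).ge
      linarith
  · rintro ⟨hV, hF⟩
    have h1 : G.hamiltonian d ψ = -(∑ v, powerAverage (G.vertexUnitary d v) ψ)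
        - ∑ f, powerAverage (G.faceUnitary d f) ψ := by
      simp [hamiltonian]
    rw [h1, Finset.sum_congr rfl fun v _ => powerAverage_apply_of_fixed (hV v),
      Finset.sum_congr rfl fun f _ => powerAverage_apply_of_fixed (hF f), Finset.sum_const,
      Finset.sum_const, Finset.card_univ, Finset.card_univ, ← Nat.cast_smul_eq_nsmul ℂ,
      ← Nat.cast_smul_eq_nsmul ℂ]
    push_cast
    module

variable {d} in
omit [Fintype F] in
/-- A vector is fixed by all `a_v` and `b_f` if and only if it is invariant under coboundaries and
supported on the cocycles. -/
theorem fixed_iff {ψ : StateSpace E d} :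
    ((∀ v, G.vertexUnitary d v ψ = ψ) ∧ ∀ f, G.faceUnitary d f ψ = ψ)
      ↔ (∀ b ∈ G.coboundaries d, ∀ k, ψ (k - b) = ψ k) ∧ ∀ k ∉ G.cocycles d, ψ k = 0 := by
  simp only [vertexUnitary_fixed_iff, faceUnitary_fixed_iff]
  refine and_congr ⟨fun h b hb => ?_, fun h v => h _ (G.star_mem_coboundaries d v)⟩
    ⟨fun h k hk => ?_, fun h f k hk => h k fun h0 => hk (congrFun (LinearMap.mem_ker.1 h0) f)⟩
  · let S : AddSubgroup (E → ZMod d) :=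
      { carrier := {b | ∀ k, ψ (k - b) = ψ k}
        zero_mem' := fun k => by rw [sub_zero]
        add_mem' := fun {a b} ha hb k => by rw [← sub_sub, hb, ha]
        neg_mem' := fun {a} ha k => by rw [sub_neg_eq_add, ← ha (k + a), add_sub_cancel_right] }
    exact G.mem_of_mem_coboundaries (S := S) h hb
  · by_contra hψ
    exact hk (LinearMap.mem_ker.2 (funext fun f => by_contra fun hf => hψ (h f k hf)))

-- The translated state is supported on the coset of `c` modulo coboundaries and constant there; the
-- coset consists of cocycles because `c` is one.
omit [Fintype F] in
theorem opX_Psi₀_fixed (c : G.cocycles d) :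
    (∀ v, G.vertexUnitary d v (opX (c : E → ZMod d) (G.Psi₀ d)) = opX (c : E → ZMod d) (G.Psi₀ d))
      ∧ ∀ f, G.faceUnitary d f (opX (c : E → ZMod d) (G.Psi₀ d))
        = opX (c : E → ZMod d) (G.Psi₀ d) := by
  rw [fixed_iff]
  simp only [opX_apply, Psi₀_apply]
  refine ⟨fun b hb k => ?_, fun k hk => if_neg fun h => hk ?_⟩
  · rw [sub_right_comm, Submodule.sub_mem_iff_left _ hb]
  · simpa using add_mem (G.coboundaries_le_cocycles d h) c.2

theorem groundEnergy_hamiltonian :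
    groundEnergy (G.hamiltonian d) = -(Fintype.card V + Fintype.card F : ℝ) := by
  refine IsLeast.csInf_eq ⟨?_, fun x hx => ?_⟩
  · refine Module.End.hasEigenvalue_of_hasEigenvector (x := G.Psi₀ d)
      ⟨Module.End.mem_eigenspace_iff.2 (G.hamiltonian_apply_eq_iff.2 ?_), fun h => ?_⟩
    -- `Psi₀` is its own translate by the zero cocycle, so the bound is attained.
    · have h := G.opX_Psi₀_fixed d 0
      have h1 : opX ((0 : G.cocycles d) : E → ZMod d) (G.Psi₀ d) = G.Psi₀ d := by
        ext k
        simp [opX_apply]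
      rwa [h1] at h
    · have h1 := G.norm_Psi₀ d
      rw [h, norm_zero] at h1
      exact zero_ne_one h1
  · obtain ⟨ψ, hψ, hne⟩ := Module.End.HasEigenvalue.exists_hasEigenvector hx
    have h := G.le_re_inner_hamiltonian ψ
    rw [Module.End.mem_eigenspace_iff.1 hψ, inner_smul_right, Complex.re_ofReal_mul] at h
    have h0 : (inner ℂ ψ ψ).re = ‖ψ‖ ^ 2 := inner_self_eq_norm_sq (𝕜 := ℂ) ψ
    rw [h0] at h
    exact le_of_mul_le_mul_right h (pow_pos (norm_pos_iff.2 hne) 2)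

variable {d} in
theorem mem_groundStateSpace_iff {ψ : StateSpace E d} : ψ ∈ G.groundStateSpace d
    ↔ (∀ v, G.vertexUnitary d v ψ = ψ) ∧ ∀ f, G.faceUnitary d f ψ = ψ := by
  rw [groundStateSpace, Module.End.mem_eigenspace_iff, groundEnergy_hamiltonian,
    hamiltonian_apply_eq_iff]

/-! ### Cohomology classes and the basis of the ground state space. -/

variable {d} in
omit [Fintype F] [NeZero d] [DecidableEq E] in
theorem cohomologyClass_eq_iff {c c' : G.cocycles d} :
    G.cohomologyClass d c = G.cohomologyClass d c'
      ↔ (c : E → ZMod d) - c' ∈ G.coboundaries d := by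
  rw [cohomologyClass, cohomologyClass, Submodule.Quotient.eq]
  rfl

variable {d} in
/-- Representatives of the cohomology classes give an orthonormal basis of the ground states. -/
theorem orthonormal_and_span_eq {ι : Type*} [Finite ι] (θ : ι ≃ G.H1 d) (γ : ι → G.cocycles d)
    (hγ : ∀ p, G.cohomologyClass d (γ p) = θ p) :
    Orthonormal ℂ (fun p => opX (γ p : E → ZMod d) (G.Psi₀ d)) ∧
    Submodule.span ℂ (Set.range (fun p => opX (γ p : E → ZMod d) (G.Psi₀ d)))
      = G.groundStateSpace d := by
  classical
  have := Fintype.ofFinite ι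
  have hinj : ∀ p q, (γ p : E → ZMod d) - γ q ∈ G.coboundaries d → p = q := by
    intro p q h
    rw [← cohomologyClass_eq_iff, hγ, hγ] at h
    exact θ.injective h
  have hc : (G.normConst d : ℂ) ≠ 0 := Complex.ofReal_ne_zero.2 (G.normConst_pos d).ne'
  refine ⟨⟨fun p => ?_, fun p q hpq => ?_⟩, le_antisymm ?_ fun ψ hψ => ?_⟩
  · rw [LinearIsometryEquiv.norm_map, norm_Psi₀]
  -- Different indices give disjoint cosets, so every summand of the inner product vanishes.
  · change inner ℂ _ _ = (0 : ℂ)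
    rw [PiLp.inner_apply]
    refine Finset.sum_eq_zero fun k _ => ?_
    simp only [opX_apply, Psi₀_apply]
    by_cases hp : k - (γ p : E → ZMod d) ∈ G.coboundaries d
    · rw [if_neg (c := k - (γ q : E → ZMod d) ∈ G.coboundaries d) fun hq =>
        hpq (hinj p q (by simpa using sub_mem hq hp)), inner_zero_right]
    · rw [if_neg hp, inner_zero_left]
  · rw [Submodule.span_le]
    rintro _ ⟨p, rfl⟩
    exact G.mem_groundStateSpace_iff.2 (G.opX_Psi₀_fixed d (γ p))
  · obtain ⟨hB, hZ⟩ := G.fixed_iff.1 (G.mem_groundStateSpace_iff.1 hψ)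
    -- `ψ` is constant on each coset, so its value at the representative, divided by the height
    -- `normConst` of the basis state, is the coefficient.
    have hsum : ψ = ∑ p, ((G.normConst d : ℂ)⁻¹ * ψ (γ p : E → ZMod d)) •
        opX (γ p : E → ZMod d) (G.Psi₀ d) := by
      ext k
      have h1 : (∑ p, ((G.normConst d : ℂ)⁻¹ * ψ (γ p : E → ZMod d)) •
          opX (γ p : E → ZMod d) (G.Psi₀ d)) k
          = ∑ p, if k - (γ p : E → ZMod d) ∈ G.coboundaries d then ψ (γ p : E → ZMod d) else 0 := by
        rw [WithLp.ofLp_sum, Finset.sum_apply]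
        refine Finset.sum_congr rfl fun p _ => ?_
        rw [PiLp.smul_apply, opX_apply, Psi₀_apply, smul_eq_mul]
        split_ifs
        · field_simp
        · rw [mul_zero]
      rw [h1]
      -- A cocycle lies in exactly one of the cosets, so a single summand survives; off the cocycles
      -- both sides vanish.
      by_cases hk : k ∈ G.cocycles d
      · obtain ⟨p, hp⟩ := θ.surjective (G.cohomologyClass d ⟨k, hk⟩)
        have hkp : k - (γ p : E → ZMod d) ∈ G.coboundaries d :=
          G.cohomologyClass_eq_iff.1 ((hγ p).trans hp).symm
        rw [Finset.sum_eq_single p, if_pos hkp, ← hB _ hkp k, sub_sub_cancel]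
        · exact fun q _ hq => if_neg fun hkq => hq (hinj q p (by simpa using sub_mem hkp hkq))
        · simp
      · rw [hZ k hk, Finset.sum_eq_zero]
        exact fun p _ => if_neg fun h =>
          hk (by simpa using add_mem (G.coboundaries_le_cocycles d h) (γ p).2)
    rw [hsum]
    exact Submodule.sum_mem _ fun p _ =>
      Submodule.smul_mem _ _ (Submodule.subset_span (Set.mem_range_self p))

end PolygonDecomposition

end KitaevModel

end

theorem mainTheorem7 {V E F : Type*} [Fintype V] [Fintype E] [Fintype F]
    [DecidableEq V] [DecidableEq E] [DecidableEq F]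
    (G : KitaevModel.PolygonDecomposition V E F) (g : ℕ) (hg : G.HasGenus g)
    (d : ℕ) [NeZero d] :
    Nonempty (((Fin g → ZMod d) × (Fin g → ZMod d)) ≃+ G.H1 d) ∧
    ∀ (θ : ((Fin g → ZMod d) × (Fin g → ZMod d)) ≃+ G.H1 d)
      (γ : (Fin g → ZMod d) × (Fin g → ZMod d) → G.cocycles d),
      (∀ p, G.cohomologyClass d (γ p) = θ p) →
        Orthonormal ℂ (fun p => KitaevModel.opX (γ p : E → ZMod d) (G.Psi₀ d)) ∧
        Submodule.span ℂ
            (Set.range (fun p => KitaevModel.opX (γ p : E → ZMod d) (G.Psi₀ d))) =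
          G.groundStateSpace d := by
  exact ⟨G.nonempty_addEquiv_H1 d hg, fun θ γ hγ => G.orthonormal_and_span_eq θ.toEquiv γ hγ⟩
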